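/- Let $n$ be a natural number, let $R=\mathbb{Q}[x_1,\dots,x_n]$ with its standard grading, and let $M$ be a finitely generated ($\mathbb{Z}$-)graded $R$-module of Krull dimension $d$ (so $M\neq 0$) with $d+1\le n$. Suppose that $M$ has a pure resolution of type $(d_0,\dots,d_p)$ with Betti numbers $\beta_0,\dots,\beta_p$; that is, $d_0<d_1<\dots<d_p$ are integers and the minimal graded free resolution of $M$ has the form $$0\to R(-d_p)^{\beta_p}\to\cdots\to R(-d_1)^{\beta_1}\to R(-d_0)^{\beta_0}\to M\to 0,$$ with all $\beta_i\ge 1$, so that $p$ is the projective dimension of $M$. Then $$\sum_{i=0}^p(-1)^i\beta_i=0,$$ and $$\sum_{i=0}^p(-1)^i\beta_i\,d_i(d_i-1)\cdots(d_i-j+1)=0\qquad\text{for each } j=1,\dots,n-d-1.$$ -/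

import Mathlib

/-- The polynomial ring `R = ℚ[x₁, …, xₙ]`. -/
abbrev PolyRing (n : ℕ) : Type := MvPolynomial (Fin n) ℚ

/-- The degree `s` piece of `R` with its standard grading, for an integer `s`
(it is zero for negative `s`). -/
noncomputable def polyPiece (n : ℕ) (s : ℤ) : Submodule ℚ (PolyRing n) :=
  if 0 ≤ s then MvPolynomial.homogeneousSubmodule (Fin n) ℚ s.toNat else ⊥

/-- The degree `t` piece of the twisted free graded module `⨁ₖ R(-aₖ)`: the vectors whose
`k`-th coordinate is a form of degree `t - aₖ`. -/
def twistedFreePiece (n : ℕ) {r : ℕ} (a : Fin r → ℤ) (t : ℤ) :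
    Submodule ℚ (Fin r → PolyRing n) where
  carrier := {v | ∀ k, v k ∈ polyPiece n (t - a k)}
  add_mem' hv hw k := Submodule.add_mem _ (hv k) (hw k)
  zero_mem' _ := Submodule.zero_mem _
  smul_mem' c _ hv k := Submodule.smul_mem _ c (hv k)

/-- `M = ⨁ₜ ℳ t` is a (`ℤ`-)graded module over the standard graded ring `R`. -/
structure IsGradedModule {n : ℕ} {M : Type*} [AddCommGroup M] [Module (PolyRing n) M]
    [Module ℚ M] (ℳ : ℤ → Submodule ℚ M) : Prop where
  isInternal : DirectSum.IsInternal ℳ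
  smul_mem : ∀ (s : ℕ) (t : ℤ) (f : PolyRing n) (m : M),
    f.IsHomogeneous s → m ∈ ℳ t → f • m ∈ ℳ (s + t)

/-- A minimal graded free resolution
`0 → F_p → ⋯ → F_1 → F_0 → M → 0` of the graded module `M = ⨁ₜ ℳ t`, where
`F_i = ⨁ₖ R(-shift i k)` has rank `rank i`. The number `rank i` is the `i`-th total Betti number
of `M`, and the length `p` is the projective dimension of `M`. -/
structure MinimalGradedFreeResolution {n : ℕ} {M : Type*} [AddCommGroup M]
    [Module (PolyRing n) M] [Module ℚ M] (ℳ : ℤ → Submodule ℚ M) (p : ℕ) where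
  rank : ℕ → ℕ
  /-- The modules `F_0, …, F_p` are the nonzero ones. -/
  rank_ne_zero_iff : ∀ i, rank i ≠ 0 ↔ i ≤ p
  shift : (i : ℕ) → Fin (rank i) → ℤ
  aug : (Fin (rank 0) → PolyRing n) →ₗ[PolyRing n] M
  diff : (i : ℕ) → (Fin (rank (i + 1)) → PolyRing n) →ₗ[PolyRing n] (Fin (rank i) → PolyRing n)
  /-- The maps are homogeneous of degree zero. -/
  aug_mem : ∀ (t : ℤ) v, v ∈ twistedFreePiece n (shift 0) t → aug v ∈ ℳ t
  diff_mem : ∀ (i : ℕ) (t : ℤ) v, v ∈ twistedFreePiece n (shift (i + 1)) t →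
    diff i v ∈ twistedFreePiece n (shift i) t
  /-- The sequence is exact. -/
  aug_surjective : Function.Surjective aug
  exact_zero : Function.Exact (diff 0) aug
  exact_succ : ∀ i, Function.Exact (diff (i + 1)) (diff i)
  /-- Minimality: the image of `F_{i+1}` lies in `𝔪 F_i`, with `𝔪 = (x₁, …, xₙ)`. -/
  minimal : ∀ (i : ℕ) v k,
    diff i v k ∈ Ideal.span (Set.range (MvPolynomial.X : Fin n → PolyRing n))

/-- The graded module `M = ⨁ₜ ℳ t` has a pure resolution of type `(d_0, …, d_p)`, with
`d_0 < ⋯ < d_p`, and its total Betti numbers are `β_0, …, β_p`. -/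
def HasPureResolution {n : ℕ} {M : Type*} [AddCommGroup M]
    [Module (PolyRing n) M] [Module ℚ M] (ℳ : ℤ → Submodule ℚ M) (p : ℕ)
    (d : Fin (p + 1) → ℤ) (β : Fin (p + 1) → ℕ) : Prop :=
  StrictMono d ∧ ∃ F : MinimalGradedFreeResolution (n := n) ℳ p,
    ∀ i : Fin (p + 1), F.rank i = β i ∧ ∀ k, F.shift i k = d i

/-! Write `e` for the dimension of `M` and count dimensions in degrees at most `t` along the
resolution. For `t ≥ d_p` exactness gives `∑ (-1)^i β_i (n + t - d_i).choose n = dim φ((F_0)_{≤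
t})`, with `φ : F_0 → M` the augmentation. The right side is `O(t ^ e)`, by Noether normalization of
`R / Ann M` (`exists_finrank_map_compLeft_restrictTotalDegree_le`). So with `g = (X + n).choose n`,
of degree `n`, the polynomial `∑ (-1)^i β_i g(X - d_i)` has degree at most `e`. Its coefficient at
`X^(n-m)`, for `m < n - e`, is `∑ (-1)^i β_i r_m(d_i)` with `deg r_m = m`. These `r_m` span the
polynomials `q` of degree below `n - e`, so `∑ (-1)^i β_i q(d_i) = 0` for all of them; falling
factorials give the theorem. -/

/-! ### Growth of finitely generated algebras. -/

open MvPolynomial in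
/-- The polynomials of degree at most `u` in `n` variables form a space of dimension
`(n + u).choose n`. -/
theorem finrank_restrictTotalDegree (n u : ℕ) (K : Type*) [Field K] :
    Module.finrank K (restrictTotalDegree (Fin n) K u) = (n + u).choose n := by
  classical
  have e : ({s : Fin n →₀ ℕ | (s.sum fun _ e => e) ≤ u} : Set _) =
      ↑((Finset.range (u + 1)).biUnion fun k => (Finset.univ : Finset (Fin n)).finsuppAntidiag k) := by
    ext s
    simp [Finsupp.sum_fintype]
  rw [restrictTotalDegree, Module.finrank_eq_nat_card_basis (basisRestrictSupport K _), e, Nat.card_coe_set_eq,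
    Set.ncard_coe_finset, Finset.card_biUnion]
  · simp only [Finset.card_finsuppAntidiag_nat_eq_multichoose, Finset.card_univ, Fintype.card_fin]
    rw [Nat.sum_range_multichoose, add_comm]
  · intro i _ j _ hij
    rw [Function.onFun, Finset.disjoint_left]
    intro s hs hs'
    rw [Finset.mem_finsuppAntidiag] at hs hs'
    exact hij (hs.1.symm.trans hs'.1)

theorem add_choose_mul_le (s c u : ℕ) :
    (s + c * (u + 1)).choose s ≤ (s + c) ^ s * (u + 1) ^ s := by
  rw [← mul_pow]
  refine (Nat.choose_le_pow _ _).trans (Nat.pow_le_pow_left ?_ s)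
  nlinarith [Nat.zero_le (s * u)]

/-- Krull dimension does not drop along injective integral maps. -/
theorem ringKrullDim_le_of_injective_isIntegral {A S : Type*} [CommRing A] [CommRing S]
    (g : A →+* S) (hinj : Function.Injective g) (hint : g.IsIntegral) :
    ringKrullDim A ≤ ringKrullDim S := by
  algebraize [g]
  have : FaithfulSMul A S := (faithfulSMul_iff_algebraMap_injective A S).mpr hinj
  refine iSup_le fun l => ?_
  -- Lying over supplies a prime above the bottom of the chain; going up lifts the rest without
  -- changing its length.
  obtain ⟨Q, hQ, hlo⟩ := (inferInstance : Nonempty (Ideal.primesOver l.head.asIdeal S))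
  obtain ⟨L, hL, -⟩ := Ideal.exists_ltSeries_of_hasGoingUp l Q
  rw [← hL]
  exact Order.LTSeries.length_le_krullDim L

open MvPolynomial in
/-- If `S` is finite over a polynomial ring in `s` variables, then the elements of `S` that are
polynomials of degree at most `u` in fixed elements span a space of dimension `O(u ^ s)`. -/
theorem exists_finrank_map_restrictTotalDegree_le {K S : Type*} [Field K] [CommRing S] [Algebra K S]
    {n s : ℕ} (π : MvPolynomial (Fin n) K →ₐ[K] S) (g : MvPolynomial (Fin s) K →ₐ[K] S)
    (hg : g.Finite) :
    ∃ C : ℕ, ∀ u : ℕ, Module.finrank K ((restrictTotalDegree (Fin n) K u).map π.toLinearMap) ≤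
      C * (u + 1) ^ s := by
  classical
  let A := MvPolynomial (Fin s) K
  algebraize [g.toRingHom]
  have : IsScalarTower K A S := IsScalarTower.of_algebraMap_eq' g.comp_algebraMap.symm
  have : Module.Finite A S := hg
  obtain ⟨m, Φ, hΦ⟩ := Module.Finite.exists_fin' A S
  let W : ℕ → Submodule K (Fin m → A) := fun k =>
    Submodule.pi Set.univ fun _ => restrictTotalDegree (Fin s) K k
  have hW : ∀ k v, v ∈ W k ↔ ∀ j, (v j).totalDegree ≤ k := fun k v => by
    simp only [W, Submodule.mem_pi, Set.mem_univ, true_implies]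
    exact forall_congr' fun j => mem_restrictTotalDegree _ _ _
  choose σ hσ using hΦ
  let N : (Fin m → A) → ℕ := fun v => Finset.univ.sup fun j => (v j).totalDegree
  have hN : ∀ v j, (v j).totalDegree ≤ N v := fun v j =>
    Finset.le_sup (f := fun j => (v j).totalDegree) (Finset.mem_univ j)
  let y : Fin n → Fin m → (Fin m → A) := fun i j => σ (π (X i) * Φ (Pi.single j 1))
  -- `c` bounds the degrees of the chosen lifts of `1` and of every `x_i` times a generator, so
  -- multiplication by `x_i` costs at most `c` degrees.
  let c : ℕ := N (σ 1) + ∑ i, ∑ j, N (y i j)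
  have hyc : ∀ i j l, (y i j l).totalDegree ≤ c := fun i j l =>
    (hN _ l).trans <| (Finset.single_le_sum (f := fun j => N (y i j)) (fun _ _ => Nat.zero_le _)
      (Finset.mem_univ j)).trans <| (Finset.single_le_sum (f := fun i => ∑ j, N (y i j))
        (fun _ _ => Nat.zero_le _) (Finset.mem_univ i)).trans <| Nat.le_add_left _ _
  let Φ' : (Fin m → A) →ₗ[K] S := Φ.restrictScalars K
  have hstep : ∀ i k z, z ∈ (W k).map Φ' → π (X i) * z ∈ (W (c + k)).map Φ' := by
    rintro i k _ ⟨v, hv, rfl⟩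
    refine ⟨∑ j, v j • y i j, ?_, ?_⟩
    · rw [SetLike.mem_coe, hW] at hv ⊢
      intro l
      rw [Finset.sum_apply]
      refine totalDegree_finsetSum_le fun j _ => ?_
      refine (totalDegree_mul _ _).trans ?_
      rw [add_comm]
      exact add_le_add (hyc i j l) (hv j)
    · have hv' : v = ∑ j, v j • (Pi.single j (1 : A) : Fin m → A) := by
        funext l
        simp [Finset.sum_apply, Pi.single_apply]
      change Φ _ = _ * Φ v
      conv_rhs => rw [hv']
      rw [map_sum, map_sum, Finset.mul_sum]
      refine Finset.sum_congr rfl fun j _ => ?_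
      rw [map_smul, map_smul, mul_smul_comm, hσ]
  have hmono : ∀ k k', k ≤ k' → (W k).map Φ' ≤ (W k').map Φ' := fun k k' h =>
    Submodule.map_mono fun v hv => (hW _ _).2 fun j => ((hW _ _).1 hv j).trans h
  -- The extra `1` in `u + 1` pays for the lift of `1`.
  have hmon : ∀ (u : ℕ) (a : Fin n →₀ ℕ), a.degree = u →
      π (monomial a 1) ∈ (W (c * (u + 1))).map Φ' := by
    intro u
    induction u with
    | zero =>
      intro a ha
      rw [(Finsupp.degree_eq_zero_iff a).1 ha]
      refine ⟨σ 1, (hW _ _).2 fun j => (hN _ j).trans ?_, ?_⟩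
      · rw [zero_add, mul_one]; exact Nat.le_add_right _ _
      · change Φ (σ 1) = π 1
        rw [hσ, map_one]
    | succ u ih =>
      intro a ha
      obtain ⟨i, hi⟩ : ∃ i, a i ≠ 0 := by
        by_contra! h
        have : a = 0 := Finsupp.ext h
        simp [this] at ha
      have hle : Finsupp.single i 1 ≤ a := by
        rw [Finsupp.single_le_iff]; exact Nat.one_le_iff_ne_zero.2 hi
      have hsum : Finsupp.single i 1 + (a - Finsupp.single i 1) = a := add_tsub_cancel_of_le hle
      have hdeg : (a - Finsupp.single i 1).degree = u := by
        have := congrArg Finsupp.degree hsum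
        rw [map_add, Finsupp.degree_single] at this
        omega
      have e : (monomial a (1 : K)) = X i * monomial (a - Finsupp.single i 1) 1 := by
        rw [X, monomial_mul, hsum, one_mul]
      rw [e, map_mul, show c * (u + 1 + 1) = c + c * (u + 1) by ring]
      exact hstep _ _ _ (ih _ hdeg)
  refine ⟨m * (s + c) ^ s, fun u => ?_⟩
  have hsub : (restrictTotalDegree (Fin n) K u).map π.toLinearMap ≤ (W (c * (u + 1))).map Φ' := by
    rw [restrictTotalDegree, restrictSupport_eq_span, Submodule.map_span, Submodule.span_le]
    rintro _ ⟨_, ⟨a, ha, rfl⟩, rfl⟩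
    exact hmono _ _ (Nat.mul_le_mul_left c (Nat.succ_le_succ ha)) (hmon _ a rfl)
  let ι : (Fin m → restrictTotalDegree (Fin s) K (c * (u + 1))) →ₗ[K] S :=
    Φ' ∘ₗ (restrictTotalDegree (Fin s) K (c * (u + 1))).subtype.compLeft (Fin m)
  have hι : (W (c * (u + 1))).map Φ' ≤ LinearMap.range ι := by
    rintro _ ⟨v, hv, rfl⟩
    exact ⟨fun j => ⟨v j, hv j (Set.mem_univ j)⟩, rfl⟩
  refine (Submodule.finrank_mono (hsub.trans hι)).trans ((LinearMap.finrank_range_le ι).trans ?_)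
  rw [Module.finrank_pi_fintype, Finset.sum_const, Finset.card_univ, Fintype.card_fin, smul_eq_mul,
    finrank_restrictTotalDegree, mul_assoc]
  exact Nat.mul_le_mul_left m (add_choose_mul_le s c u)

open MvPolynomial in
/-- If `I` is a proper ideal of `K[x₁, …, xₙ]` whose quotient has dimension `d`, the classes of the
polynomials of degree at most `u` span a space of dimension `O(u ^ d)`. -/
theorem exists_finrank_map_mk_restrictTotalDegree_le {K : Type*} [Field K] {n d : ℕ}
    (I : Ideal (MvPolynomial (Fin n) K)) (hd : ringKrullDim (MvPolynomial (Fin n) K ⧸ I) = d) :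
    ∃ C : ℕ, ∀ u : ℕ, Module.finrank K
      ((restrictTotalDegree (Fin n) K u).map (Ideal.Quotient.mkₐ K I).toLinearMap) ≤
        C * (u + 1) ^ d := by
  have hI : I ≠ ⊤ := by
    rintro rfl
    rw [ringKrullDim_eq_bot_of_subsingleton] at hd
    exact absurd hd.symm (by simp)
  have : Nontrivial (MvPolynomial (Fin n) K ⧸ I) := Ideal.Quotient.nontrivial_iff.2 hI
  obtain ⟨s, g, hinj, hfin⟩ := exists_finite_inj_algHom_of_fg K (MvPolynomial (Fin n) K ⧸ I)
  have hs : s ≤ d := by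
    have := ringKrullDim_le_of_injective_isIntegral g.toRingHom hinj hfin.to_isIntegral
    rw [hd, MvPolynomial.ringKrullDim_of_isNoetherianRing, ringKrullDim_eq_zero_of_field,
      zero_add, Nat.card_eq_fintype_card, Fintype.card_fin] at this
    exact_mod_cast this
  obtain ⟨C, hC⟩ := exists_finrank_map_restrictTotalDegree_le (Ideal.Quotient.mkₐ K I) g hfin
  exact ⟨C, fun u => (hC u).trans (Nat.mul_le_mul_left C (Nat.pow_le_pow_right u.succ_pos hs))⟩

/-! ### Growth and translates of univariate polynomials. -/

open Polynomial Filter in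
/-- A polynomial that is bounded on large natural numbers by `C (t + c) ^ d` has degree at most `d`. -/
theorem Polynomial.natDegree_le_of_abs_eval_natCast_le (P : ℚ[X]) (d : ℕ) (C c : ℚ)
    (h : ∀ᶠ t : ℕ in atTop, |P.eval (t : ℚ)| ≤ C * ((t : ℚ) + c) ^ d) : P.natDegree ≤ d := by
  by_contra! hlt
  have hP : P ≠ 0 := by rintro rfl; simp at hlt
  have hdeg : ((X + Polynomial.C c) ^ d : ℚ[X]).degree < P.degree := by
    rw [degree_pow, degree_X_add_C, degree_eq_natDegree hP, nsmul_one]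
    exact_mod_cast hlt
  have hlim := (abs_div_tendsto_atTop_atTop_of_degree_gt P _ hdeg
    (pow_ne_zero _ (X_add_C_ne_zero c))).comp (tendsto_natCast_atTop_atTop (R := ℚ))
  obtain ⟨t, ht, hC, hpos⟩ := (h.and ((hlim.eventually_gt_atTop C).and
    ((tendsto_natCast_atTop_atTop (R := ℚ)).eventually_gt_atTop (-c)))).exists
  have hpos' : 0 < ((t : ℚ) + c) ^ d := pow_pos (by linarith) d
  simp only [Function.comp_apply, eval_pow, eval_add, eval_X, eval_C, abs_div,
    abs_of_pos hpos'] at hC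
  rw [lt_div_iff₀ hpos'] at hC
  exact absurd ht (not_le.2 hC)

open Polynomial in
/-- If a combination of translates `∑ cᵢ g(X - dᵢ)` of a polynomial of degree `n` has degree
at most `e`, then `∑ cᵢ q(dᵢ) = 0` for all polynomials `q` of degree less than `n - e`. -/
theorem Polynomial.sum_mul_eval_eq_zero_of_natDegree_sum_taylor_le {ι : Type*} [Fintype ι]
    (c d : ι → ℚ) (g : ℚ[X]) (e : ℕ)
    (h : (∑ i, c i • taylor (-d i) g).natDegree ≤ e) (q : ℚ[X]) (hq : q.natDegree + e < g.natDegree) :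
    ∑ i, c i * q.eval (d i) = 0 := by
  induction hm : q.natDegree using Nat.strong_induction_on generalizing q with
  | _ m ih =>
  subst hm
  set m := q.natDegree with hm
  -- `r(y)` is the coefficient of `X^(deg g - m)` in `g(X - y)`. That exponent exceeds `e`, and `r`
  -- has degree exactly `m`, so a multiple of `r` removes the top term of `q`.
  let r : ℚ[X] := (hasseDeriv (g.natDegree - m) g).comp (-X)
  have hr : ∑ i, c i * r.eval (d i) = 0 := by
    have := coeff_eq_zero_of_natDegree_lt (p := ∑ i, c i • taylor (-d i) g) (n := g.natDegree - m)
      (by omega)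
    simpa [finsetSum_coeff, taylor_coeff, r] using this
  have hdm : (hasseDeriv (g.natDegree - m) g).natDegree ≤ m := by
    have := natDegree_hasseDeriv_le g (g.natDegree - m)
    omega
  have hrm : r.natDegree ≤ m := by
    simpa [r, natDegree_comp] using hdm
  have hrc : r.coeff m ≠ 0 := by
    have hg : g ≠ 0 := by rintro rfl; simp at hq
    have e1 : m + (g.natDegree - m) = g.natDegree := by omega
    rw [show r = (hasseDeriv (g.natDegree - m) g).comp (C (-1) * X) by simp [r],
      comp_C_mul_X_coeff, hasseDeriv_coeff, e1]
    have : g.natDegree.choose (g.natDegree - m) ≠ 0 := (Nat.choose_pos (by omega)).ne'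
    have h2 : g.coeff g.natDegree ≠ 0 := by simpa using hg
    positivity
  set a := q.coeff m / r.coeff m with ha
  have hsub : ∑ i, c i * (q - C a * r).eval (d i) = ∑ i, c i * q.eval (d i) := by
    have : ∑ i, c i * (q - C a * r).eval (d i) =
        ∑ i, c i * q.eval (d i) - a * ∑ i, c i * r.eval (d i) := by
      rw [Finset.mul_sum, ← Finset.sum_sub_distrib]
      refine Finset.sum_congr rfl fun i _ => ?_
      simp only [eval_sub, eval_mul, eval_C]
      ring
    rw [this, hr, mul_zero, sub_zero]
  rw [← hsub]
  have hle : (q - C a * r).natDegree ≤ m :=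
    (natDegree_sub_le _ _).trans (max_le le_rfl ((natDegree_C_mul_le _ _).trans hrm))
  have hcoeff : (q - C a * r).coeff m = 0 := by
    rw [coeff_sub, coeff_C_mul, ha, div_mul_cancel₀ _ hrc, sub_self]
  rcases Nat.lt_or_ge (q - C a * r).natDegree m with hlt | hge
  · exact ih _ hlt _ (by omega) rfl
  -- The degree can fail to drop only when `m = 0`.
  · have h0 : q - C a * r = 0 := by
      have := le_antisymm hle hge
      rwa [← this, coeff_natDegree, leadingCoeff_eq_zero] at hcoeff
    simp [h0]

/-! ### Degree filtrations on twisted free modules. -/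

/-- The vectors in `⨁ₖ R(-aₖ)` all of whose terms have (twisted) degree in `T`. -/
noncomputable def twistedFreeSupported (n : ℕ) {r : ℕ} (a : Fin r → ℤ) (T : Set ℤ) :
    Submodule ℚ (Fin r → PolyRing n) :=
  Submodule.pi Set.univ fun k =>
    MvPolynomial.restrictSupport ℚ {s : Fin n →₀ ℕ | (s.degree : ℤ) + a k ∈ T}

section

variable {n r r' : ℕ} {a : Fin r → ℤ} {b : Fin r' → ℤ}

theorem mem_twistedFreeSupported {T : Set ℤ} {v : Fin r → PolyRing n} :
    v ∈ twistedFreeSupported n a T ↔ ∀ k, ∀ s ∈ (v k).support, (s.degree : ℤ) + a k ∈ T := by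
  simp [twistedFreeSupported, Submodule.mem_pi, MvPolynomial.mem_restrictSupport_iff,
    Set.subset_def]

theorem twistedFreePiece_le_supported {T : Set ℤ} {t : ℤ} (ht : t ∈ T) :
    twistedFreePiece n a t ≤ twistedFreeSupported n a T := by
  intro v hv
  rw [mem_twistedFreeSupported]
  intro k s hs
  have hk : v k ∈ polyPiece n (t - a k) := hv k
  rw [polyPiece] at hk
  split_ifs at hk with h0
  · have := ((MvPolynomial.mem_homogeneousSubmodule _ _).1 hk).degree_eq_sum_deg_support hs
    have e : (s.degree : ℤ) + a k = t := by
      have h1 : (t - a k).toNat = s.degree := this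
      omega
    rwa [e]
  · rw [Submodule.mem_bot] at hk
    simp [hk] at hs

theorem single_monomial_mem_twistedFreePiece (k : Fin r) (s : Fin n →₀ ℕ) (c : ℚ) :
    Pi.single k (MvPolynomial.monomial s c) ∈ twistedFreePiece n a ((s.degree : ℤ) + a k) := by
  intro l
  rcases eq_or_ne l k with rfl | h
  · rw [Pi.single_eq_same, add_sub_cancel_right, polyPiece, if_pos (Int.natCast_nonneg _)]
    exact MvPolynomial.isHomogeneous_monomial _ (by simp)
  · rw [Pi.single_eq_of_ne h]
    exact Submodule.zero_mem _

/-- A homogeneous map of degree zero preserves the set of degrees that occur. -/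
theorem map_mem_twistedFreeSupported
    (L : (Fin r → PolyRing n) →ₗ[PolyRing n] (Fin r' → PolyRing n))
    (hL : ∀ t v, v ∈ twistedFreePiece n a t → L v ∈ twistedFreePiece n b t)
    {T : Set ℤ} {v : Fin r → PolyRing n} (hv : v ∈ twistedFreeSupported n a T) :
    L v ∈ twistedFreeSupported n b T := by
  rw [mem_twistedFreeSupported] at hv
  have e : v = ∑ k, ∑ s ∈ (v k).support,
      Pi.single k (MvPolynomial.monomial s ((v k).coeff s)) := by
    conv_lhs => rw [← Finset.univ_sum_single v]
    refine Finset.sum_congr rfl fun k _ => ?_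
    conv_lhs => rw [(v k).as_sum]
    exact map_sum (AddMonoidHom.single (fun _ : Fin r => PolyRing n) k) _ _
  rw [e, map_sum]
  refine Submodule.sum_mem _ fun k _ => ?_
  rw [map_sum]
  exact Submodule.sum_mem _ fun s hs => twistedFreePiece_le_supported (hv k s hs)
    (hL _ _ (single_monomial_mem_twistedFreePiece k s _))

theorem exists_add_twistedFreeSupported (a : Fin r → ℤ) (T : Set ℤ) (v : Fin r → PolyRing n) :
    ∃ v₁ ∈ twistedFreeSupported n a T, ∃ v₂ ∈ twistedFreeSupported n a Tᶜ, v = v₁ + v₂ := by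
  classical
  have key : ∀ k, ∃ f g : PolyRing n, (∀ s ∈ f.support, (s.degree : ℤ) + a k ∈ T) ∧
      (∀ s ∈ g.support, (s.degree : ℤ) + a k ∉ T) ∧ v k = f + g := by
    intro k
    refine ⟨∑ s ∈ (v k).support with (s.degree : ℤ) + a k ∈ T,
        MvPolynomial.monomial s ((v k).coeff s),
      ∑ s ∈ (v k).support with ¬ (s.degree : ℤ) + a k ∈ T,
        MvPolynomial.monomial s ((v k).coeff s), ?_, ?_, ?_⟩
    · intro s hs
      obtain ⟨s', hs', h⟩ := Finset.mem_biUnion.1 (MvPolynomial.support_sum hs)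
      rw [Finset.mem_singleton.1 (MvPolynomial.support_monomial_subset h)]
      exact (Finset.mem_filter.1 hs').2
    · intro s hs
      obtain ⟨s', hs', h⟩ := Finset.mem_biUnion.1 (MvPolynomial.support_sum hs)
      rw [Finset.mem_singleton.1 (MvPolynomial.support_monomial_subset h)]
      exact (Finset.mem_filter.1 hs').2
    · rw [Finset.sum_filter_add_sum_filter_not]
      exact (v k).as_sum
  choose f g hf hg h using key
  exact ⟨f, mem_twistedFreeSupported.2 hf, g, mem_twistedFreeSupported.2 hg, funext h⟩

theorem disjoint_twistedFreeSupported_compl (T : Set ℤ) {v : Fin r → PolyRing n}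
    (h : v ∈ twistedFreeSupported n a T) (h' : v ∈ twistedFreeSupported n a Tᶜ) : v = 0 := by
  rw [mem_twistedFreeSupported] at h h'
  funext k
  rw [Pi.zero_apply, ← MvPolynomial.support_eq_empty, Finset.eq_empty_iff_forall_notMem]
  exact fun s hs => h' k s hs (h k s hs)

/-- Homogeneous maps of degree zero are strict for the filtrations by degree. -/
theorem map_twistedFreeSupported_eq
    (L : (Fin r → PolyRing n) →ₗ[PolyRing n] (Fin r' → PolyRing n))
    (hL : ∀ t v, v ∈ twistedFreePiece n a t → L v ∈ twistedFreePiece n b t) (T : Set ℤ) :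
    (twistedFreeSupported n a T).map (L.restrictScalars ℚ) =
      twistedFreeSupported n b T ⊓ LinearMap.range (L.restrictScalars ℚ) := by
  apply le_antisymm
  · rintro _ ⟨v, hv, rfl⟩
    exact ⟨map_mem_twistedFreeSupported L hL hv, v, rfl⟩
  · rintro _ ⟨hw, v, rfl⟩
    obtain ⟨v₁, h₁, v₂, h₂, rfl⟩ := exists_add_twistedFreeSupported a T v
    have h₂' := map_mem_twistedFreeSupported L hL h₂
    have h₁' := map_mem_twistedFreeSupported L hL h₁
    have hw' : L (v₁ + v₂) ∈ twistedFreeSupported n b T := hw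
    rw [map_add] at hw'
    -- `L v₂` has its degrees both in `T` and in its complement.
    have h0 : L v₂ = 0 := disjoint_twistedFreeSupported_compl T
      ((Submodule.add_mem_iff_right _ h₁').1 hw') h₂'
    refine ⟨v₁, h₁, ?_⟩
    change L v₁ = L (v₁ + v₂)
    rw [map_add, h0, add_zero]

theorem twistedFreeSupported_Iic_eq {d t : ℤ} (ha : ∀ k, a k = d) (ht : d ≤ t) :
    twistedFreeSupported n a (Set.Iic t) = LinearMap.range
      ((MvPolynomial.restrictTotalDegree (Fin n) ℚ (t - d).toNat).subtype.compLeft (Fin r)) := by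
  have key : ∀ f : PolyRing n, f ∈ MvPolynomial.restrictTotalDegree (Fin n) ℚ (t - d).toNat ↔
      ∀ s ∈ f.support, (s.degree : ℤ) + d ∈ Set.Iic t := by
    intro f
    rw [MvPolynomial.restrictTotalDegree, MvPolynomial.mem_restrictSupport_iff]
    refine forall₂_congr fun s _ => ?_
    change s.degree ≤ (t - d).toNat ↔ (s.degree : ℤ) + d ≤ t
    omega
  ext v
  rw [mem_twistedFreeSupported]
  simp only [ha, ← key]
  constructor
  · exact fun h => ⟨fun k => ⟨v k, h k⟩, rfl⟩
  · rintro ⟨w, rfl⟩ k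
    exact (w k).2

theorem finiteDimensional_twistedFreeSupported_Iic {d t : ℤ} (ha : ∀ k, a k = d) (ht : d ≤ t) :
    FiniteDimensional ℚ (twistedFreeSupported n a (Set.Iic t)) := by
  rw [twistedFreeSupported_Iic_eq ha ht]
  infer_instance

theorem finrank_twistedFreeSupported_Iic {d t : ℤ} (ha : ∀ k, a k = d) (ht : d ≤ t) :
    Module.finrank ℚ (twistedFreeSupported n a (Set.Iic t)) =
      r * (n + (t - d).toNat).choose n := by
  rw [twistedFreeSupported_Iic_eq ha ht, LinearMap.finrank_range_of_inj,
    Module.finrank_pi_fintype, Finset.sum_const, Finset.card_univ, Fintype.card_fin, smul_eq_mul,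
    finrank_restrictTotalDegree]
  intro v w h
  funext k
  exact Subtype.ext (congrFun h k)

end

theorem Submodule.finrank_map_add_finrank_inf_ker {K V W : Type*} [Field K] [AddCommGroup V]
    [Module K V] [AddCommGroup W] [Module K W] (f : V →ₗ[K] W) (p : Submodule K V)
    [FiniteDimensional K p] :
    Module.finrank K (p.map f) + Module.finrank K (p ⊓ LinearMap.ker f : Submodule K V) =
      Module.finrank K p := by
  rw [← LinearMap.finrank_range_add_finrank_ker (f.domRestrict p), LinearMap.range_domRestrict,
    LinearMap.ker_domRestrict]
  congr 1
  rw [← Submodule.map_comap_subtype]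
  exact Submodule.finrank_map_subtype_eq _ _

/-! ### Growth of `M` and the Euler characteristic of the resolution. -/

/-- If `M` has dimension `d`, the combinations of `x₁, …, xᵣ ∈ M` with coefficients of degree at
most `u` span a space of dimension `O(u ^ d)`. -/
theorem exists_finrank_map_compLeft_restrictTotalDegree_le {n : ℕ} {M : Type*} [AddCommGroup M]
    [Module (PolyRing n) M] [Module ℚ M] [IsScalarTower ℚ (PolyRing n) M]
    [Module.Finite (PolyRing n) M] {d : ℕ} (hd : Module.supportDim (PolyRing n) M = d) {r : ℕ}
    (φ : (Fin r → PolyRing n) →ₗ[PolyRing n] M) :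
    ∃ C : ℕ, ∀ u : ℕ, Module.finrank ℚ ((LinearMap.range
      ((MvPolynomial.restrictTotalDegree (Fin n) ℚ u).subtype.compLeft (Fin r))).map
        (φ.restrictScalars ℚ)) ≤ C * (u + 1) ^ d := by
  rw [Module.supportDim_eq_ringKrullDim_quotient_annihilator] at hd
  set I := Module.annihilator (PolyRing n) M with hI
  obtain ⟨C, hC⟩ := exists_finrank_map_mk_restrictTotalDegree_le I hd
  refine ⟨r * C, fun u => ?_⟩
  let B := (MvPolynomial.restrictTotalDegree (Fin n) ℚ u).map
    (Ideal.Quotient.mkₐ ℚ I).toLinearMap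
  -- Scalars act on `M` through `R / Ann M`, so the count reduces to `r` copies of that ring.
  let ψ : M → (PolyRing n ⧸ I) →ₗ[PolyRing n] M := fun x =>
    Submodule.liftQ I (LinearMap.toSpanSingleton (PolyRing n) M x) fun f hf => by
      rw [LinearMap.mem_ker, LinearMap.toSpanSingleton_apply]
      exact Module.mem_annihilator.1 hf x
  let Ψ : (Fin r → B) →ₗ[ℚ] M := ∑ k, ((ψ (φ (Pi.single k 1))).restrictScalars ℚ) ∘ₗ
    B.subtype ∘ₗ LinearMap.proj k
  have hle : (LinearMap.range
      ((MvPolynomial.restrictTotalDegree (Fin n) ℚ u).subtype.compLeft (Fin r))).map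
        (φ.restrictScalars ℚ) ≤ LinearMap.range Ψ := by
    rintro _ ⟨_, ⟨w, rfl⟩, rfl⟩
    refine ⟨fun k => ⟨Ideal.Quotient.mkₐ ℚ I (w k), Submodule.mem_map_of_mem (w k).2⟩, ?_⟩
    have e : (fun k => (w k : PolyRing n)) =
        ∑ k, (w k : PolyRing n) • (Pi.single k (1 : PolyRing n) : Fin r → PolyRing n) := by
      funext l
      simp [Finset.sum_apply, Pi.single_apply]
    change _ = φ (fun k => (w k : PolyRing n))
    rw [e, map_sum, LinearMap.sum_apply]
    refine Finset.sum_congr rfl fun k _ => ?_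
    rw [map_smul]
    rfl
  refine (Submodule.finrank_mono hle).trans ((LinearMap.finrank_range_le Ψ).trans ?_)
  rw [Module.finrank_pi_fintype, Finset.sum_const, Finset.card_univ, Fintype.card_fin, smul_eq_mul,
    mul_assoc]
  exact Nat.mul_le_mul_left r (hC u)

namespace MinimalGradedFreeResolution

variable {n : ℕ} {M : Type*} [AddCommGroup M] [Module (PolyRing n) M] [Module ℚ M]
  [IsScalarTower ℚ (PolyRing n) M] {ℳ : ℤ → Submodule ℚ M} {p : ℕ}

/-- The part of the `i`-th free module in degrees at most `t`. -/
noncomputable def filtration (F : MinimalGradedFreeResolution (n := n) ℳ p) (t : ℤ) (i : ℕ) :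
    Submodule ℚ (Fin (F.rank i) → PolyRing n) :=
  twistedFreeSupported n (F.shift i) (Set.Iic t)

theorem alternating_sum_finrank_filtration (F : MinimalGradedFreeResolution (n := n) ℳ p) (t : ℤ)
    (hfin : ∀ i, FiniteDimensional ℚ (F.filtration t i)) :
    ∑ i ∈ Finset.range (p + 1), (-1 : ℤ) ^ i * Module.finrank ℚ (F.filtration t i) =
      Module.finrank ℚ ((F.filtration t 0).map (F.aug.restrictScalars ℚ)) := by
  -- Dimension of the boundaries in `F_i`; by strictness and exactness they are all the cycles
  -- there, so the alternating sum telescopes.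
  let m : ℕ → ℕ := fun i =>
    Module.finrank ℚ ((F.filtration t (i + 1)).map ((F.diff i).restrictScalars ℚ))
  have hzero : Module.finrank ℚ (F.filtration t 0) =
      Module.finrank ℚ ((F.filtration t 0).map (F.aug.restrictScalars ℚ)) + m 0 := by
    have e : (F.filtration t 1).map ((F.diff 0).restrictScalars ℚ) =
        F.filtration t 0 ⊓ LinearMap.ker (F.aug.restrictScalars ℚ) := by
      refine (map_twistedFreeSupported_eq (F.diff 0) (F.diff_mem 0) _).trans ?_
      ext v
      exact and_congr_right fun _ => (F.exact_zero v).symm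
    rw [← Submodule.finrank_map_add_finrank_inf_ker (F.aug.restrictScalars ℚ), ← e]
  have hsucc : ∀ i, Module.finrank ℚ (F.filtration t (i + 1)) = m i + m (i + 1) := by
    intro i
    have e : (F.filtration t (i + 2)).map ((F.diff (i + 1)).restrictScalars ℚ) =
        F.filtration t (i + 1) ⊓ LinearMap.ker ((F.diff i).restrictScalars ℚ) := by
      refine (map_twistedFreeSupported_eq (F.diff (i + 1)) (F.diff_mem (i + 1)) _).trans ?_
      ext v
      exact and_congr_right fun _ => (F.exact_succ i v).symm
    rw [← Submodule.finrank_map_add_finrank_inf_ker ((F.diff i).restrictScalars ℚ), ← e]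
  have hsum : ∀ k, ∑ i ∈ Finset.range (k + 1), (-1 : ℤ) ^ i * Module.finrank ℚ (F.filtration t i) =
      Module.finrank ℚ ((F.filtration t 0).map (F.aug.restrictScalars ℚ)) + (-1) ^ k * m k := by
    intro k
    induction k with
    | zero => simp [hzero]
    | succ k ih =>
      rw [Finset.sum_range_succ, ih, hsucc]
      push_cast
      ring
  have hlast : m p = 0 := by
    have hr : F.rank (p + 1) = 0 := by
      by_contra h
      exact absurd ((F.rank_ne_zero_iff (p + 1)).1 h) (by omega)
    have : IsEmpty (Fin (F.rank (p + 1))) := by rw [hr]; infer_instance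
    have hbot : F.filtration t (p + 1) = ⊥ := Subsingleton.elim _ _
    simp [m, hbot]
  rw [hsum, hlast]
  simp

end MinimalGradedFreeResolution

open Polynomial Filter in
/-- The Herzog–Kühl equations of a pure resolution, tested against any polynomial of degree
less than the codimension. -/
theorem HasPureResolution.sum_mul_eval_eq_zero {n : ℕ} {M : Type*} [AddCommGroup M]
    [Module (PolyRing n) M] [Module ℚ M] [IsScalarTower ℚ (PolyRing n) M]
    [Module.Finite (PolyRing n) M] {ℳ : ℤ → Submodule ℚ M} {p : ℕ} {d : Fin (p + 1) → ℤ}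
    {β : Fin (p + 1) → ℕ} (hpure : HasPureResolution (n := n) ℳ p d β) {e : ℕ}
    (hdim : Module.supportDim (PolyRing n) M = e) (q : ℚ[X]) (hq : q.natDegree + e < n) :
    ∑ i : Fin (p + 1), (-1 : ℚ) ^ (i : ℕ) * (β i : ℚ) * q.eval (d i : ℚ) = 0 := by
  obtain ⟨hd, F, hF⟩ := hpure
  have hrank : ∀ i : Fin (p + 1), F.rank i = β i := fun i => (hF i).1
  have hshift : ∀ (i : Fin (p + 1)) k, F.shift i k = d i := fun i => (hF i).2
  have hshift_zero : ∀ k, F.shift 0 k = d 0 := hshift 0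
  refine Polynomial.sum_mul_eval_eq_zero_of_natDegree_sum_taylor_le _ _ (preHilbertPoly ℚ n 0) e
    ?_ q (by rwa [natDegree_preHilbertPoly])
  obtain ⟨C, hC⟩ := exists_finrank_map_compLeft_restrictTotalDegree_le hdim F.aug
  -- The shift `1 - d 0` turns `t + c` into `u + 1` with `u = t - d 0`.
  refine natDegree_le_of_abs_eval_natCast_le _ e C (1 - d 0) ?_
  -- For `t ≥ d_p` every `t - d_i` is a natural number, where the binomial polynomial is the true
  -- dimension.
  filter_upwards [eventually_ge_atTop (d (Fin.last p)).toNat] with t ht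
  have hdt : ∀ i, d i ≤ t := fun i =>
    (hd.monotone (Fin.le_last i)).trans (by omega)
  have hfin : ∀ i, FiniteDimensional ℚ (F.filtration t i) := by
    intro i
    by_cases hi : i < p + 1
    · exact finiteDimensional_twistedFreeSupported_Iic (hshift ⟨i, hi⟩) (hdt ⟨i, hi⟩)
    · have hr : F.rank i = 0 := by
        by_contra h
        exact hi (Nat.lt_succ_of_le ((F.rank_ne_zero_iff i).1 h))
      have : IsEmpty (Fin (F.rank i)) := by rw [hr]; infer_instance
      exact finiteDimensional_twistedFreeSupported_Iic (d := (t : ℤ)) (fun k => isEmptyElim k) le_rfl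
  have heval : (∑ i : Fin (p + 1), ((-1 : ℚ) ^ (i : ℕ) * (β i : ℚ)) •
      taylor (-(d i : ℚ)) (preHilbertPoly ℚ n 0)).eval (t : ℚ) =
      Module.finrank ℚ ((F.filtration t 0).map (F.aug.restrictScalars ℚ)) := by
    have := congrArg (Int.cast : ℤ → ℚ) (F.alternating_sum_finrank_filtration t hfin)
    rw [Int.cast_natCast] at this
    rw [← this, Finset.sum_range, eval_finsetSum, Int.cast_sum]
    refine Finset.sum_congr rfl fun i _ => ?_
    have hcast : (t : ℚ) + -(d i : ℚ) = ((((t : ℤ) - d i).toNat : ℕ) : ℚ) := by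
      have h : ((((t : ℤ) - d i).toNat : ℕ) : ℤ) = (t : ℤ) - d i :=
        Int.toNat_of_nonneg (sub_nonneg.2 (hdt i))
      have h' := congrArg (Int.cast : ℤ → ℚ) h
      push_cast at h'
      rw [h', sub_eq_add_neg]
    rw [eval_smul, taylor_eval, hcast, preHilbertPoly_eq_choose_sub_add ℚ n (Nat.zero_le _),
      MinimalGradedFreeResolution.filtration,
      finrank_twistedFreeSupported_Iic (hshift i) (hdt i), hrank, tsub_zero, add_comm n]
    push_cast
    rw [smul_eq_mul, mul_assoc]
  rw [heval, Nat.abs_cast, MinimalGradedFreeResolution.filtration,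
    twistedFreeSupported_Iic_eq hshift_zero (hdt 0)]
  have h : ((((t : ℤ) - d 0).toNat : ℕ) : ℤ) = (t : ℤ) - d 0 :=
    Int.toNat_of_nonneg (sub_nonneg.2 (hdt 0))
  have h' := congrArg (Int.cast : ℤ → ℚ) h
  push_cast at h'
  rw [show (t : ℚ) + (1 - d 0) = (((t : ℤ) - d 0).toNat : ℕ) + 1 by rw [h']; ring]
  exact_mod_cast hC _

theorem theorem4p2 (n : ℕ) {M : Type*} [AddCommGroup M] [Module (PolyRing n) M]
    [Module ℚ M] [IsScalarTower ℚ (PolyRing n) M] [Module.Finite (PolyRing n) M]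
    (ℳ : ℤ → Submodule ℚ M) (hℳ : IsGradedModule (n := n) ℳ)
    (p : ℕ) (d : Fin (p + 1) → ℤ) (β : Fin (p + 1) → ℕ)
    (hpure : HasPureResolution (n := n) ℳ p d β)
    (dimM : ℕ) (hdim : Module.supportDim (PolyRing n) M = dimM) (hn : dimM + 1 ≤ n) :
    (∑ i : Fin (p + 1), (-1 : ℤ) ^ (i : ℕ) * (β i : ℤ) = 0) ∧
    ∀ j : ℕ, 1 ≤ j → j ≤ n - dimM - 1 →
      ∑ i : Fin (p + 1), (-1 : ℤ) ^ (i : ℕ) * (β i : ℤ) *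
        ∏ l ∈ Finset.range j, (d i - (l : ℤ)) = 0 := by
  -- The empty product at `j = 0` yields the first identity.
  have key : ∀ j : ℕ, j ≤ n - dimM - 1 →
      ∑ i : Fin (p + 1), (-1 : ℤ) ^ (i : ℕ) * (β i : ℤ) *
        ∏ l ∈ Finset.range j, (d i - (l : ℤ)) = 0 := by
    intro j hj
    have h := hpure.sum_mul_eval_eq_zero hdim
      (∏ l ∈ Finset.range j, (Polynomial.X - Polynomial.C (l : ℚ)))
      (by rw [Polynomial.natDegree_finsetProd_X_sub_C_eq_card, Finset.card_range]; omega)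
    simp only [Polynomial.eval_prod, Polynomial.eval_sub, Polynomial.eval_X,
      Polynomial.eval_C] at h
    exact_mod_cast h
  exact ⟨by simpa using key 0 (Nat.zero_le _), fun j _ hj => key j hj⟩
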